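/- **Setting.** Let $K\ge 2$, let $(X,Y)$ take values in $[0,1]^d\times\{e_1,\dots,e_K\}$ ($e_k$ the standard basis vectors of $\mathbb R^K$) and let $\mathcal D_n=\{(X_i,Y_i)\}_{i=1}^n$ be i.i.d. copies of $(X,Y)$, independent of $(X,Y)$. Let $\mathbf p_0=(p^0_1,\dots,p^0_K)$, $p_k^0(x)=\mathbb P(Y=e_k\mid X=x)$, be the true conditional class probabilities (any measurable version with values in the probability simplex $\mathcal S^K$). Let $\mathcal F$ be a class of measurable functions $\mathbf p:[0,1]^d\to\mathcal S^K$, and let $\widehat{\mathbf p}$ be an estimator (a function of the data, jointly measurable in the data and $x$) with values in $\mathcal F$. Logarithms act componentwise, $\log(\mathbf u/\mathbf v)=\log \mathbf u-\log\mathbf v$, $\log 0=-\infty$ and $0\cdot(\pm\infty)=0$. Put $$R_B(\mathbf p_0,\widehat{\mathbf p})=\mathbb E_{\mathcal D_n,X}\Big[\mathbf p_0(X)^\top\Big(B\wedge\log\frac{\mathbf p_0(X)}{\widehat{\mathbf p}(X)}\Big)\Big],\qquad R(\mathbf p_0,\mathbf p)=\mathbb E_X\Big[\mathbf p_0(X)^\top\log\frac{\mathbf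 p_0(X)}{\mathbf p(X)}\Big]\in[0,\infty],$$ $$\Delta_n(\mathbf p_0,\widehat{\mathbf p})=\mathbb E_{\mathcal D_n}\Big[-\frac1n\sum_{i=1}^n Y_i^\top\log\widehat{\mathbf p}(X_i)-\inf_{\mathbf p\in\mathcal F}\Big(-\frac1n\sum_{i=1}^n Y_i^\top\log\mathbf p(X_i)\Big)\Big]\in[0,\infty],$$ where the difference is read as $0$ if all members of $\mathcal F$ have infinite loss at the data. For $\tau\in\mathbb R$ let $$d_\tau(\mathbf f,\mathbf g)=\sup_{x\in[0,1]^d}\max_{1\le k\le K}\big|(\tau\vee f_k(x))-(\tau\vee g_k(x))\big|,$$ and let $\mathcal N(r,\mathcal G,d_\tau)\in\mathbb N\cup\{\infty\}$ be the interior covering number: the least number of closed $d_\tau$-balls of radius $r$ with centers in $\mathcal G$ that cover $\mathcal G$. Let $\log(\mathcal F)=\{\log \mathbf f:\mathbf f\in\mathcal F\}$. **Corollary.** Let $\delta,\epsilon\in(0,1]$, $0<C_n\le ne^{-1}$, $B\ge2$, $\tau=C_ne^{-B}/n$ and $$\widetilde{\mathcal N}_n=\mathcal N\big(\delta C_ne^{-B}/n,\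 \mathcal F,\ d_\tau\big).$$ Suppose that $\mathcal N(\delta,\log(\mathcal F),d_{\log\tau})\ge3$, or that $\widetilde{\mathcal N}_n\ge 3$. Then $$R_B(\mathbf p_0,\widehat{\mathbf p})\le(1+\epsilon)\Big(\inf_{\mathbf p\in\mathcal F}R(\mathbf p_0,\mathbf p)+\Delta_n(\mathbf p_0,\widehat{\mathbf p})+3\delta\Big)+\frac{(1+\epsilon)^2}{\epsilon}\cdot\frac{68B\log(\widetilde{\mathcal N}_n)+272B+\frac32C_nK\big(\log(n/C_n)+B\big)}{n}.$$ -/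

import Mathlib

open MeasureTheory
open scoped ENNReal

namespace OracleCE

noncomputable section

/-- The covariate space `[0,1]^d`, with its product (Borel) σ-algebra. -/
abbrev Cube (d : ℕ) : Type := Fin d → unitInterval

/-- One observation `(X, Y)`. The response `Y` is coded by the label `k` of the class;
the response vector is the standard basis vector `oneHot k`. -/
abbrev Obs (d K : ℕ) : Type := Cube d × Fin K

/-- A data set of size `n`. -/
abbrev Data (n d K : ℕ) : Type := Fin n → Obs d K

/-- Vector-valued functions on the cube. -/
abbrev Func (d K : ℕ) : Type := Cube d → Fin K → ℝ

/-- The `k`-th standard basis vector. -/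
def oneHot {K : ℕ} (k : Fin K) : Fin K → ℝ≥0∞ := Pi.single k 1

/-- The logarithm on `[0, ∞)` with `log 0 = -∞`. -/
def elog (x : ℝ) : EReal := ENNReal.log (ENNReal.ofReal x)

/-- `F` is a class of conditional class probabilities: measurable functions from `[0,1]^d`
to the probability simplex. -/
def IsProbClass {d K : ℕ} (F : Set (Func d K)) : Prop :=
  ∀ p ∈ F, Measurable p ∧ ∀ x, p x ∈ stdSimplex ℝ (Fin K)

/-- `p₀` is (a version of) the vector of conditional class probabilities
`x ↦ (ℙ(Y = e_k | X = x))_k` of the law `P` of `(X, Y)`. -/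
def IsTrueProb {d K : ℕ} (P : Measure (Obs d K)) (p₀ : Func d K) : Prop :=
  Measurable p₀ ∧ (∀ x, p₀ x ∈ stdSimplex ℝ (Fin K)) ∧
    ∀ (k : Fin K) (A : Set (Cube d)), MeasurableSet A →
      P (A ×ˢ {k}) = ∫⁻ x in A, ENNReal.ofReal (p₀ x k) ∂P.fst

/-- An estimator with values in `F`: a function of the data, jointly measurable in the data
and the evaluation point. -/
def IsEstimator {n d K : ℕ} (F : Set (Func d K)) (phat : Data n d K → Func d K) : Prop :=
  (∀ D, phat D ∈ F) ∧ Measurable (fun z : Data n d K × Cube d => phat z.1 z.2)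

/-- The law of `n` i.i.d. copies of `(X, Y)`. -/
def dataLaw {d K : ℕ} (n : ℕ) (P : Measure (Obs d K)) : Measure (Data n d K) :=
  Measure.pi (fun _ => P)

/-- The `B`-truncated Kullback-Leibler divergence `pᵀ (B ∧ log (p / q))` of probability vectors,
where `log (p / q) = log p - log q`, and `0 * (± ∞) = 0` as in `EReal`.
`B = ⊤` gives the Kullback-Leibler divergence. -/
def truncKL {K : ℕ} (B : EReal) (p q : Fin K → ℝ) : EReal :=
  ∑ k, (p k : EReal) * min B (elog (p k) - elog (q k))

/-- The truncated Kullback-Leibler risk `R_B(p₀, phat)`: expectation over the data and an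
independent copy of `X`. It is used for `B ≥ 2` only, where the divergence is nonnegative
(so that `EReal.toENNReal` does not change it). -/
def truncRisk {n d K : ℕ} (P : Measure (Obs d K)) (B : ℝ) (p₀ : Func d K)
    (phat : Data n d K → Func d K) : ℝ≥0∞ :=
  ∫⁻ z : Data n d K × Cube d, (truncKL (B : EReal) (p₀ z.2) (phat z.1 z.2)).toENNReal
    ∂((dataLaw n P).prod P.fst)

/-- The Kullback-Leibler risk `R(p₀, p) = 𝔼_X [KL(p₀(X), p(X))]` of a fixed function `p`,
a number in `[0, ∞]`. -/
def risk {d K : ℕ} (P : Measure (Obs d K)) (p₀ p : Func d K) : ℝ≥0∞ :=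
  ∫⁻ x, (truncKL ⊤ (p₀ x) (p x)).toENNReal ∂P.fst

/-- The cross-entropy loss `-(1/n) ∑ᵢ Yᵢᵀ log p(Xᵢ)`, a number in `[0, ∞]`
(as `-log p ≥ 0` and `0 * ∞ = 0`). -/
def empLoss {n d K : ℕ} (p : Func d K) (D : Data n d K) : ℝ≥0∞ :=
  (n : ℝ≥0∞)⁻¹ * ∑ i, ∑ k, oneHot (D i).2 k * (-elog (p (D i).1 k)).toENNReal

/-- `Δ_n(p₀, phat)`: the expected difference between the empirical loss of the estimator and
the smallest empirical loss over `F`. The difference is `≥ 0`, since `phat D ∈ F`; it is read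
as `0` for data at which every member of `F` has infinite loss. -/
def optGap {n d K : ℕ} (P : Measure (Obs d K)) (F : Set (Func d K))
    (phat : Data n d K → Func d K) : ℝ≥0∞ :=
  ∫⁻ D, (empLoss (phat D) D - ⨅ p ∈ F, empLoss p D) ∂(dataLaw n P)

/-- For `t : α → ℝ`, the pseudometric `sup_x max_k |t (f_k(x)) - t (g_k(x))|` on functions
from the cube to `α^K`. -/
@[reducible] def supPseudo (d K : ℕ) {α : Type} (t : α → ℝ) :
    PseudoEMetricSpace (Cube d → Fin K → α) where
  edist f g := ⨆ x, ⨆ k, ENNReal.ofReal |t (f x k) - t (g x k)|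
  edist_self f := by simp
  edist_comm f g := by simp only [abs_sub_comm]
  edist_triangle f g h := by
    refine iSup_le fun x => iSup_le fun k => ?_
    calc ENNReal.ofReal |t (f x k) - t (h x k)|
        ≤ ENNReal.ofReal (|t (f x k) - t (g x k)| + |t (g x k) - t (h x k)|) :=
          ENNReal.ofReal_le_ofReal (abs_sub_le _ _ _)
      _ = ENNReal.ofReal |t (f x k) - t (g x k)| + ENNReal.ofReal |t (g x k) - t (h x k)| :=
          ENNReal.ofReal_add (abs_nonneg _) (abs_nonneg _)
      _ ≤ _ := add_le_add
          (le_iSup₂ (f := fun x k => ENNReal.ofReal |t (f x k) - t (g x k)|) x k)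
          (le_iSup₂ (f := fun x k => ENNReal.ofReal |t (g x k) - t (h x k)|) x k)

/-- The truncated pseudometric `d_τ(f,g) = sup_x max_k |(τ ∨ f_k(x)) - (τ ∨ g_k(x))|`
on real functions. -/
@[reducible] def truncPseudo (d K : ℕ) (τ : ℝ) : PseudoEMetricSpace (Func d K) :=
  supPseudo d K (fun v : ℝ => max τ v)

/-- The same pseudometric on functions with values in `[-∞, ∞)`;
there `τ ∨ v` is a real number. -/
@[reducible] def truncPseudoE (d K : ℕ) (τ : ℝ) :
    PseudoEMetricSpace (Cube d → Fin K → EReal) :=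
  supPseudo d K (fun v : EReal => (max (τ : EReal) v).toReal)

/-- The interior covering number `𝒩(δ, F, d_τ)` (centers in `F`). -/
def coverNum {d K : ℕ} (δ : ℝ) (F : Set (Func d K)) (τ : ℝ) : ℕ∞ :=
  @Metric.coveringNumber _ (truncPseudo d K τ) δ.toNNReal F

/-- The interior covering number `𝒩(δ, G, d_τ)` of a class `G` of functions with values in
`[-∞, ∞)`. -/
def coverNumE {d K : ℕ} (δ : ℝ) (G : Set (Cube d → Fin K → EReal)) (τ : ℝ) : ℕ∞ :=
  @Metric.coveringNumber _ (truncPseudoE d K τ) δ.toNNReal G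

/-- The class `log(F) = {log f : f ∈ F}`, with the logarithm applied to each component. -/
def logClass {d K : ℕ} (F : Set (Func d K)) : Set (Cube d → Fin K → EReal) :=
  (fun f x k => elog (f x k)) '' F

/-- `log N` for a covering number `N ≥ 1`, a number in `[0, ∞]` with `log ∞ = ∞`. -/
def logNum (N : ℕ∞) : ℝ≥0∞ := (ENNReal.log (N : ℝ≥0∞)).toENNReal

end

end OracleCE

/-!
Write `L_q(x, k) = B ∧ log (p₀ₖ(x) / qₖ(x))` for the truncated log-likelihood ratio of a candidate
`q`. Its mean under the law of `(X, Y)` is the truncated risk of `q`, and its empirical mean is at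
most the difference between the empirical losses of `q` and `p₀`. For the estimator, the expected
empirical mean is therefore at most `Δ_n + R(p₀, p)` for each `p` in the class
(`OracleCE.ofReal_integral_empRatio_le`). It remains to pass from the empirical mean to the mean.

This is done with exponential moments. For probability vectors, `∑ₖ p₀ₖ φ(Lₖ)` with
`φ(L) = e^{-L} - 1 + L` is at most twice the truncated divergence `∑ₖ p₀ₖ Lₖ`
(`OracleCE.sum_exp_remainder_le`), while `e^{-sL} - 1 + sL ≤ s² B φ(L)` for `L ≤ B` and `0 ≤ s ≤ 1`
(`OracleCE.exp_remainder_le`). So `𝔼 e^{-s L_q} ≤ exp (-(s - 2 s² B) 𝔼 L_q)`: the variance is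
controlled by the mean. With `s = ε / (2 B (1 + ε))`, the exponential moment of
`n s (𝔼 L_q / (1 + ε) - mean of L_q over the sample)` is at most `1` for each fixed `q`, and its
maximum over a net of `N` elements costs `log N`; this gives the term of order
`(1 + ε)² / ε * B log N / n` (`OracleCE.integral_meanRatio_le`).

The estimator is replaced by an element of the net as follows. Where `p₀ₖ ≥ C / n`, the ratio `L_q`
depends on `qₖ` only through `qₖ ∨ p₀ₖ e^{-B}`, and `p₀ₖ e^{-B} ≥ τ`, so that distance `δ τ` after
clipping at `τ` changes it by at most `δ` (`OracleCE.truncLog_sub_le`). Where `p₀ₖ < C / n`, the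
ratio varies by at most `B - log p₀ₖ`, and such classes contribute at most
`K (C / n) (B + log (n / C))` in mean, since `-u log u` increases on `[0, e⁻¹]`
(`OracleCE.mul_smallProbCost_le`).
-/

namespace OracleCE

noncomputable section

/-! ### The truncated log-likelihood ratio -/

/-- The truncated log-likelihood ratio `B ∧ log (p / q)` as a real number. Clipping `q` from below
at `p e^{-B}` is the same as truncating the ratio at `B`, and covers `q = 0`. The value at `p = 0`
is set to `0`; there the ratio only ever occurs with weight `p`. -/
def truncLog (B p q : ℝ) : ℝ :=
  if p = 0 then 0 else Real.log p - Real.log (max q (p * Real.exp (-B)))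

variable {B p q : ℝ}

lemma truncLog_zero_left : truncLog B 0 q = 0 := by simp [truncLog]

lemma truncLog_of_pos (hp : 0 < p) :
    truncLog B p q = Real.log p - Real.log (max q (p * Real.exp (-B))) := by
  simp [truncLog, hp.ne']

lemma measurable_truncLog (B : ℝ) : Measurable fun z : ℝ × ℝ => truncLog B z.1 z.2 := by
  unfold truncLog
  refine Measurable.ite (measurable_fst (measurableSet_singleton 0)) measurable_const ?_
  fun_prop

lemma truncLog_le (hB : 0 ≤ B) (hp : 0 ≤ p) : truncLog B p q ≤ B := by
  rcases hp.eq_or_lt with rfl | hp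
  · rwa [truncLog_zero_left]
  rw [truncLog_of_pos hp]
  have h : Real.log (p * Real.exp (-B)) ≤ Real.log (max q (p * Real.exp (-B))) :=
    Real.log_le_log (by positivity) (le_max_right _ _)
  rw [Real.log_mul hp.ne' (Real.exp_pos _).ne', Real.log_exp] at h
  linarith

lemma log_le_truncLog (hB : 0 ≤ B) (hp : 0 ≤ p) (hp1 : p ≤ 1) (hq1 : q ≤ 1) :
    Real.log p ≤ truncLog B p q := by
  rcases hp.eq_or_lt with rfl | hp
  · simp [truncLog_zero_left]
  rw [truncLog_of_pos hp]
  have h1 : Real.exp (-B) ≤ 1 := Real.exp_le_one_iff.2 (by linarith)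
  have h2 : max q (p * Real.exp (-B)) ≤ 1 :=
    max_le hq1 (mul_le_one₀ hp1 (Real.exp_pos _).le h1)
  have := Real.log_nonpos ((by positivity : (0:ℝ) ≤ p * Real.exp (-B)).trans (le_max_right q _)) h2
  linarith

lemma mul_exp_neg_truncLog (hp : 0 < p) :
    p * Real.exp (-truncLog B p q) = max q (p * Real.exp (-B)) := by
  have hm : 0 < max q (p * Real.exp (-B)) := lt_max_of_lt_right (by positivity)
  rw [truncLog_of_pos hp, neg_sub, Real.exp_sub, Real.exp_log hm, Real.exp_log hp]
  field_simp

/-! ### Exponential moments under a probability vector -/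

lemma exp_mul_sub_le {s a : ℝ} (hs0 : 0 ≤ s) (hs1 : s ≤ 1) (ha : 0 ≤ a) :
    Real.exp (s * a) - 1 - s * a ≤ s ^ 2 * (Real.exp a - 1 - a) := by
  have hs (x : ℝ) : HasSum (fun m : ℕ => x ^ m / (m.factorial : ℝ)) (Real.exp x) := by
    rw [Real.exp_eq_exp_ℝ]
    exact NormedSpace.expSeries_div_hasSum_exp x
  have h := ((hs a).mul_left (s ^ 2)).sub (hs (s * a))
  -- all terms of order at least two of the difference of the power series are nonnegative
  have key := sum_le_hasSum (Finset.range 2) (fun m hm => ?_) h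
  · simp [Finset.sum_range_succ] at key
    linarith
  · have hm2 : 2 ≤ m := not_lt.1 (Finset.mem_range.not.1 hm)
    have h1 : s ^ m ≤ s ^ 2 := pow_le_pow_of_le_one hs0 hs1 hm2
    have h2 : 0 ≤ a ^ m / (m.factorial : ℝ) := by positivity
    have h3 := mul_le_mul_of_nonneg_right h1 h2
    rw [mul_pow, mul_div_assoc]
    linarith

lemma exp_neg_le_quadratic {u : ℝ} (hu : 0 ≤ u) : Real.exp (-u) ≤ 1 - u + u ^ 2 / 2 := by
  have h1 := Real.quadratic_le_exp_of_nonneg hu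
  rw [Real.exp_neg, inv_le_comm₀ (Real.exp_pos _) (by nlinarith [sq_nonneg (u - 1)])]
  refine le_trans ?_ h1
  rw [inv_le_iff_one_le_mul₀ (by nlinarith [sq_nonneg (u - 1)])]
  nlinarith [sq_nonneg (u ^ 2)]

/-- On `(-∞, B]`, the second order remainder of `e^{-sL}` at `0` is at most `s² B` times the
remainder of `e^{-L}`. -/
lemma exp_remainder_le {s L : ℝ} (hs0 : 0 ≤ s) (hs1 : s ≤ 1) (hB : 2 ≤ B) (hL : L ≤ B) :
    Real.exp (-(s * L)) - 1 + s * L ≤ s ^ 2 * B * (Real.exp (-L) - 1 + L) := by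
  have hφ : 0 ≤ Real.exp (-L) - 1 + L := by linarith [Real.add_one_le_exp (-L)]
  rcases le_total L 0 with h0 | h0
  · have h := exp_mul_sub_le hs0 hs1 (neg_nonneg.2 h0)
    rw [mul_neg] at h
    have h2 : s ^ 2 * (Real.exp (-L) - 1 + L) ≤ s ^ 2 * B * (Real.exp (-L) - 1 + L) :=
      mul_le_mul_of_nonneg_right (by nlinarith [sq_nonneg s]) hφ
    linarith
  · have h1 := exp_neg_le_quadratic (mul_nonneg hs0 h0)
    have h2 : L ^ 2 / 2 ≤ B * (Real.exp (-L) - 1 + L) := by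
      rcases le_total L 2 with h | h
      · -- here `e^{-L} = (e^{-L/2})² ≥ (1 - L/2)²`
        have h3 : 1 - L / 2 ≤ Real.exp (-(L / 2)) := by
          linarith [Real.add_one_le_exp (-(L / 2))]
        have h4 : Real.exp (-L) = Real.exp (-(L / 2)) ^ 2 := by
          rw [← Real.exp_nat_mul]; congr 1; push_cast; ring
        have h5 : L ^ 2 / 4 ≤ Real.exp (-L) - 1 + L := by
          have := pow_le_pow_left₀ (by linarith) h3 2
          rw [h4]; nlinarith
        nlinarith
      · have h3 := Real.exp_pos (-L)
        nlinarith
    have := mul_le_mul_of_nonneg_left h2 (sq_nonneg s)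
    nlinarith

variable {K : ℕ} {u v : Fin K → ℝ}

lemma le_one_of_mem_stdSimplex (hu : u ∈ stdSimplex ℝ (Fin K)) (k : Fin K) :
    u k ≤ 1 :=
  hu.2 ▸ Finset.single_le_sum (f := u) (fun i _ => hu.1 i) (Finset.mem_univ k)

/-- The truncated divergence of probability vectors controls `∑ uₖ φ(Lₖ)`, where
`φ(L) = e^{-L} - 1 + L ≥ 0` and `Lₖ` are the truncated log-likelihood ratios: truncation adds
`(uₖ e^{-B} - vₖ)⁺` to `∑ uₖ e^{-Lₖ}`, which is positive only if `Lₖ = B` and then at most half of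
`uₖ φ(B)`. -/
lemma sum_exp_remainder_le (hB : 2 ≤ B) (hu : u ∈ stdSimplex ℝ (Fin K))
    (hv : v ∈ stdSimplex ℝ (Fin K)) :
    ∑ k, u k * (Real.exp (-truncLog B (u k) (v k)) - 1 + truncLog B (u k) (v k)) ≤
      2 * ∑ k, u k * truncLog B (u k) (v k) := by
  have key (k : Fin K) :
      u k * (Real.exp (-truncLog B (u k) (v k)) - 1 + truncLog B (u k) (v k)) ≤
        2 * (u k * truncLog B (u k) (v k)) + 2 * v k - 2 * u k := by
    rcases (hu.1 k).eq_or_lt with h0 | h0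
    · rw [← h0]; linarith [hv.1 k]
    · have h1 := mul_exp_neg_truncLog (B := B) (q := v k) h0
      rcases le_total (u k * Real.exp (-B)) (v k) with h | h
      · rw [max_eq_left h] at h1
        have := Real.add_one_le_exp (-truncLog B (u k) (v k))
        nlinarith
      · have h2 : truncLog B (u k) (v k) = B := by
          rw [truncLog_of_pos h0, max_eq_right h, Real.log_mul h0.ne' (Real.exp_pos _).ne',
            Real.log_exp]
          ring
        rw [h2]
        have h3 : Real.exp (-B) ≤ 1 := Real.exp_le_one_iff.2 (by linarith)
        nlinarith [hv.1 k]
  have h := Finset.sum_le_sum fun k (_ : k ∈ Finset.univ) => key k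
  rw [Finset.sum_sub_distrib, Finset.sum_add_distrib, ← Finset.mul_sum, ← Finset.mul_sum,
    ← Finset.mul_sum, hu.2, hv.2] at h
  linarith

lemma sum_mul_truncLog_nonneg (hB : 2 ≤ B) (hu : u ∈ stdSimplex ℝ (Fin K))
    (hv : v ∈ stdSimplex ℝ (Fin K)) : 0 ≤ ∑ k, u k * truncLog B (u k) (v k) := by
  have h : 0 ≤ ∑ k, u k * (Real.exp (-truncLog B (u k) (v k)) - 1 + truncLog B (u k) (v k)) :=
    Finset.sum_nonneg fun k _ => mul_nonneg (hu.1 k) <| by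
      linarith [Real.add_one_le_exp (-truncLog B (u k) (v k))]
  linarith [sum_exp_remainder_le hB hu hv]

lemma sum_mul_truncLog_le (hB : 0 ≤ B) (hu : u ∈ stdSimplex ℝ (Fin K)) (v : Fin K → ℝ) :
    ∑ k, u k * truncLog B (u k) (v k) ≤ B := by
  calc ∑ k, u k * truncLog B (u k) (v k) ≤ ∑ k, u k * B :=
        Finset.sum_le_sum fun k _ => mul_le_mul_of_nonneg_left (truncLog_le hB (hu.1 k)) (hu.1 k)
    _ = B := by rw [← Finset.sum_mul, hu.2, one_mul]

/-- The Laplace transform of the truncated log-likelihood ratio. The variance term `2 s² B` comes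
with the divergence itself as a factor, which gives a rate linear in `1 / n`. -/
lemma sum_mul_exp_neg_truncLog_le {s : ℝ} (hs0 : 0 ≤ s) (hs1 : s ≤ 1) (hB : 2 ≤ B)
    (hu : u ∈ stdSimplex ℝ (Fin K)) (hv : v ∈ stdSimplex ℝ (Fin K)) :
    ∑ k, u k * Real.exp (-(s * truncLog B (u k) (v k))) ≤
      1 - (s - 2 * s ^ 2 * B) * ∑ k, u k * truncLog B (u k) (v k) := by
  have h1 : ∑ k, u k * (Real.exp (-(s * truncLog B (u k) (v k))) - 1 +
        s * truncLog B (u k) (v k)) ≤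
      ∑ k, s ^ 2 * B * (u k * (Real.exp (-truncLog B (u k) (v k)) - 1 +
        truncLog B (u k) (v k))) := by
    refine Finset.sum_le_sum fun k _ => ?_
    have := mul_le_mul_of_nonneg_left (exp_remainder_le hs0 hs1 hB
      (truncLog_le (q := v k) (by linarith) (hu.1 k))) (hu.1 k)
    linarith
  have h2 := mul_le_mul_of_nonneg_left (sum_exp_remainder_le hB hu hv)
    (by positivity : 0 ≤ s ^ 2 * B)
  rw [← Finset.mul_sum] at h1
  have h3 : ∑ k, u k * (Real.exp (-(s * truncLog B (u k) (v k))) - 1 +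
        s * truncLog B (u k) (v k)) =
      ∑ k, u k * Real.exp (-(s * truncLog B (u k) (v k))) - 1 +
        s * ∑ k, u k * truncLog B (u k) (v k) := by
    rw [← hu.2, Finset.mul_sum, ← Finset.sum_sub_distrib, ← Finset.sum_add_distrib, hu.2]
    exact Finset.sum_congr rfl fun k _ => by ring
  rw [h3] at h1
  linarith

/-! ### Stability under uniform approximation -/

/-- The price, at a class of probability `p`, of replacing one estimate by another: an upper bound
`B - log p` for the oscillation of the truncated ratio if `p < c`, and nothing otherwise. -/
def smallProbCost (B c p : ℝ) : ℝ := if p < c then B - Real.log p else 0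

lemma measurable_smallProbCost (B c : ℝ) : Measurable (smallProbCost B c) := by
  unfold smallProbCost
  exact Measurable.ite measurableSet_Iio (by fun_prop) measurable_const

variable {c : ℝ}

lemma smallProbCost_nonneg (hB : 0 ≤ B) (hp : 0 ≤ p) (hp1 : p ≤ 1) :
    0 ≤ smallProbCost B c p := by
  unfold smallProbCost
  split_ifs
  · linarith [Real.log_nonpos hp hp1]
  · rfl

lemma mul_smallProbCost_le (hB : 0 ≤ B) (hc : 0 < c) (hce : c ≤ Real.exp (-1)) (hp : 0 ≤ p) :
    p * smallProbCost B c p ≤ c * (B - Real.log c) := by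
  have hlc : Real.log c ≤ -1 := by
    simpa using Real.log_le_log hc hce
  unfold smallProbCost
  split_ifs with h
  · -- `-p log p = -p log c + p log (c / p) ≤ -p log c + (c - p)`, and `-log c ≥ 1`
    rcases hp.eq_or_lt with rfl | hp
    · have : 0 ≤ B - Real.log c := by linarith
      rw [zero_mul]; positivity
    · have h1 : Real.log (c / p) ≤ c / p - 1 := Real.log_le_sub_one_of_pos (by positivity)
      rw [Real.log_div hc.ne' hp.ne'] at h1
      have h2 := mul_le_mul_of_nonneg_left h1 hp.le
      have h3 : p * (c / p - 1) = c - p := by field_simp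
      nlinarith
  · have : 0 ≤ B - Real.log c := by linarith
    rw [mul_zero]; positivity

/-- If `q` and `q'` are close after clipping at `τ = c e^{-B}`, the truncated ratios are close,
since for `p ≥ c` the ratio only sees `q` clipped at `p e^{-B} ≥ τ`. -/
lemma truncLog_sub_le {δ q' : ℝ} (hB : 0 ≤ B) (hc : 0 < c) (hδ : 0 ≤ δ) (hp : 0 ≤ p)
    (hp1 : p ≤ 1) (hq1' : q' ≤ 1)
    (h : |max (c * Real.exp (-B)) q - max (c * Real.exp (-B)) q'| ≤ δ * (c * Real.exp (-B))) :
    truncLog B p q - truncLog B p q' ≤ δ + smallProbCost B c p := by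
  unfold smallProbCost
  split_ifs with hpc
  · linarith [truncLog_le (q := q) hB hp, log_le_truncLog hB hp hp1 hq1']
  · have hcp : c ≤ p := not_lt.1 hpc
    have hp0 : 0 < p := hc.trans_le hcp
    set a := p * Real.exp (-B) with ha
    have ha0 : 0 < a := by positivity
    have hta : c * Real.exp (-B) ≤ a := mul_le_mul_of_nonneg_right hcp (Real.exp_pos _).le
    have h1 : max q' a - max q a ≤ δ * a := by
      have e (r : ℝ) : max r a = max (max (c * Real.exp (-B)) r) a := by
        rw [max_right_comm, max_comm (max _ a), max_eq_right hta]
      rw [e q', e q]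
      calc _ ≤ |max (max (c * Real.exp (-B)) q') a - max (max (c * Real.exp (-B)) q) a| :=
            le_abs_self _
        _ ≤ |max (c * Real.exp (-B)) q' - max (c * Real.exp (-B)) q| :=
            abs_max_sub_max_le_abs _ _ _
        _ ≤ δ * (c * Real.exp (-B)) := by rwa [abs_sub_comm]
        _ ≤ δ * a := mul_le_mul_of_nonneg_left hta hδ
    have hq : 0 < max q a := lt_max_of_lt_right ha0
    have hq' : 0 < max q' a := lt_max_of_lt_right ha0
    have h2 := Real.log_le_sub_one_of_pos (div_pos hq' hq)
    rw [Real.log_div hq'.ne' hq.ne'] at h2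
    have h3 : max q' a / max q a - 1 ≤ δ := by
      rw [div_sub_one hq.ne', div_le_iff₀ hq]
      exact h1.trans (mul_le_mul_of_nonneg_left (le_max_right _ _) hδ)
    rw [truncLog_of_pos hp0, truncLog_of_pos hp0, ← ha]
    linarith

/-! ### Extended real divergences -/

lemma elog_of_pos (hp : 0 < p) : elog p = (Real.log p : EReal) := ENNReal.log_ofReal_of_pos hp

lemma elog_zero : elog 0 = ⊥ := by simp [elog]

lemma coe_mul_min_elog_sub (hp : 0 ≤ p) (hq : 0 ≤ q) :
    (p : EReal) * min (B : EReal) (elog p - elog q) = ((p * truncLog B p q : ℝ) : EReal) := by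
  rcases hp.eq_or_lt with rfl | hp
  · simp
  rw [EReal.coe_mul, truncLog_of_pos hp, elog_of_pos hp]
  congr 1
  rcases hq.eq_or_lt with rfl | hq
  · rw [elog_zero, max_eq_right (by positivity), Real.log_mul hp.ne' (Real.exp_pos _).ne',
      Real.log_exp, EReal.coe_sub_bot, min_eq_left le_top]
    congr 1; ring
  · rw [elog_of_pos hq, ← EReal.coe_sub,
      ← EReal.coe_strictMono.monotone.map_min]
    congr 1
    have hmono : Real.log (max q (p * Real.exp (-B))) =
        max (Real.log q) (Real.log (p * Real.exp (-B))) := by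
      rcases le_total q (p * Real.exp (-B)) with h | h
      · rw [max_eq_right h, max_eq_right (Real.log_le_log hq h)]
      · rw [max_eq_left h, max_eq_left (Real.log_le_log (by positivity) h)]
    rw [hmono, Real.log_mul hp.ne' (Real.exp_pos _).ne', Real.log_exp, ← min_sub_sub_left, min_comm]
    congr 1; ring

lemma ereal_coe_sum {ι : Type*} (s : Finset ι) (f : ι → ℝ) :
    ((∑ i ∈ s, f i : ℝ) : EReal) = ∑ i ∈ s, (f i : EReal) :=
  map_sum (⟨⟨Real.toEReal, EReal.coe_zero⟩, EReal.coe_add⟩ : ℝ →+ EReal) f s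

lemma ereal_coe_ennreal_sum {ι : Type*} (s : Finset ι) (f : ι → ℝ≥0∞) :
    ((∑ i ∈ s, f i : ℝ≥0∞) : EReal) = ∑ i ∈ s, (f i : EReal) :=
  map_sum (⟨⟨((↑) : ℝ≥0∞ → EReal), EReal.coe_ennreal_zero⟩, EReal.coe_ennreal_add⟩ :
    ℝ≥0∞ →+ EReal) f s

lemma toENNReal_truncKL (hu : u ∈ stdSimplex ℝ (Fin K)) (hv : v ∈ stdSimplex ℝ (Fin K)) :
    (truncKL (B : EReal) u v).toENNReal =
      ENNReal.ofReal (∑ k, u k * truncLog B (u k) (v k)) := by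
  rw [truncKL, Finset.sum_congr rfl fun k _ => coe_mul_min_elog_sub (hu.1 k) (hv.1 k),
    ← ereal_coe_sum]
  exact EReal.real_coe_toENNReal _

/-- Cross-entropy is at most divergence plus entropy. -/
lemma crossEntropy_le (hu : u ∈ stdSimplex ℝ (Fin K)) (hv : v ∈ stdSimplex ℝ (Fin K)) :
    ∑ k, ENNReal.ofReal (u k) * (-elog (v k)).toENNReal ≤
      (truncKL ⊤ u v).toENNReal + ∑ k, ENNReal.ofReal (u k) * ENNReal.ofReal (-Real.log (u k)) := by
  have key (k : Fin K) :
      ((ENNReal.ofReal (u k) * (-elog (v k)).toENNReal : ℝ≥0∞) : EReal) =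
        (u k : EReal) * min ⊤ (elog (u k) - elog (v k)) +
          ((ENNReal.ofReal (u k) * ENNReal.ofReal (-Real.log (u k)) : ℝ≥0∞) : EReal) := by
    rcases (hu.1 k).eq_or_lt with h0 | h0
    · rw [← h0]; simp
    have hl : 0 ≤ -Real.log (u k) :=
      neg_nonneg.2 (Real.log_nonpos h0.le (le_one_of_mem_stdSimplex hu k))
    rw [EReal.coe_ennreal_mul, EReal.coe_ennreal_mul, EReal.coe_ennreal_ofReal,
      EReal.coe_ennreal_ofReal, max_eq_left h0.le, max_eq_left hl, min_eq_right le_top,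
      elog_of_pos h0]
    rcases (hv.1 k).eq_or_lt with h1 | h1
    · rw [← h1, elog_zero, EReal.coe_sub_bot, EReal.neg_bot, EReal.toENNReal_top,
        EReal.coe_ennreal_top, EReal.coe_mul_top_of_pos h0, ← EReal.coe_mul,
        EReal.top_add_coe]
    · have hl' : 0 ≤ -Real.log (v k) :=
        neg_nonneg.2 (Real.log_nonpos h1.le (le_one_of_mem_stdSimplex hv k))
      rw [elog_of_pos h1, ← EReal.coe_neg, EReal.real_coe_toENNReal, EReal.coe_ennreal_ofReal,
        max_eq_left hl', ← EReal.coe_sub, ← EReal.coe_mul, ← EReal.coe_mul, ← EReal.coe_mul,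
        ← EReal.coe_add]
      congr 1; ring
  have h := congrArg EReal.toENNReal (Finset.sum_congr (rfl : Finset.univ = _) fun k _ => key k)
  rw [Finset.sum_add_distrib, ← ereal_coe_ennreal_sum, ← ereal_coe_ennreal_sum,
    EReal.toENNReal_coe] at h
  rw [h]
  refine EReal.toENNReal_add_le.trans ?_
  rw [EReal.toENNReal_coe]
  rfl

/-- The truncated ratio is at most the ratio: `truncLog B p q - log p ≤ -log q`. For probabilities
both sides are nonnegative, so that nothing is lost in `[0, ∞]`. -/
lemma ofReal_truncLog_sub_log_le (hp : 0 ≤ p) (hq : 0 ≤ q) :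
    ENNReal.ofReal (truncLog B p q - Real.log p) ≤ (-elog q).toENNReal := by
  rcases hq.eq_or_lt with rfl | hq
  · simp [elog_zero]
  rw [elog_of_pos hq, ← EReal.coe_neg, EReal.real_coe_toENNReal]
  rcases hp.eq_or_lt with rfl | hp
  · simp [truncLog_zero_left]
  · rw [truncLog_of_pos hp]
    have := Real.log_le_log hq (le_max_left q (p * Real.exp (-B)))
    exact ENNReal.ofReal_le_ofReal (by linarith)

end

noncomputable section

/-! ### Integration against the law of an observation -/

variable {n d K : ℕ} {P : Measure (Obs d K)} {p₀ : Func d K}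

lemma measurable_prob (hp₀ : IsTrueProb P p₀) (k : Fin K) : Measurable fun x => p₀ x k :=
  (measurable_pi_apply k).comp hp₀.1

lemma measurable_uncurry_label {α : Type*} [MeasurableSpace α] {f : α → Fin K → ℝ}
    (hf : Measurable f) : Measurable fun z : α × Fin K => f z.1 z.2 :=
  measurable_from_prod_countable_left fun k => (measurable_pi_apply k).comp hf

/-- The law of `(X, Y)` is recovered from the law of `X` and the conditional class
probabilities. -/
lemma IsTrueProb.eq_sum_map (hp₀ : IsTrueProb P p₀) :
    P = ∑ k, (P.fst.withDensity fun x => ENNReal.ofReal (p₀ x k)).map fun x => (x, k) := by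
  ext S hS
  have hk (k : Fin K) : MeasurableSet ((fun x : Cube d => (x, k)) ⁻¹' S) :=
    measurable_prodMk_right hS
  have hdec : S = ⋃ k : Fin K, ((fun x : Cube d => (x, k)) ⁻¹' S) ×ˢ {k} := by
    ext ⟨x, k⟩
    simp
  rw [Measure.coe_finsetSum, Finset.sum_apply]
  conv_lhs => rw [hdec]
  rw [measure_iUnion _ fun k => (hk k).prod (measurableSet_singleton k), tsum_fintype]
  · refine Finset.sum_congr rfl fun k _ => ?_
    rw [Measure.map_apply measurable_prodMk_right hS, withDensity_apply _ (hk k)]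
    exact hp₀.2.2 k _ (hk k)
  · intro i j hij
    exact Set.disjoint_left.2 fun z hi hj => hij (hi.2.symm.trans hj.2)

lemma lintegral_obs (hp₀ : IsTrueProb P p₀) {h : Obs d K → ℝ≥0∞} (hh : Measurable h) :
    ∫⁻ z, h z ∂P = ∫⁻ x, ∑ k, ENNReal.ofReal (p₀ x k) * h (x, k) ∂P.fst := by
  have hm (k : Fin K) : Measurable fun x : Cube d => h (x, k) := hh.comp measurable_prodMk_right
  conv_lhs => rw [hp₀.eq_sum_map]
  rw [lintegral_finsetSum_measure]
  refine Eq.trans ?_ (lintegral_finsetSum _ fun k _ =>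
    ((measurable_prob hp₀ k).ennreal_ofReal.mul (hm k))).symm
  refine Finset.sum_congr rfl fun k _ => ?_
  rw [lintegral_map hh measurable_prodMk_right,
    lintegral_withDensity_eq_lintegral_mul _ (measurable_prob hp₀ k).ennreal_ofReal (hm k)]

/-! ### The truncated log-likelihood ratio of a candidate -/

/-- The truncated log-likelihood ratio of the true class probabilities against `q`, at an
observation. -/
def obsRatio (B : ℝ) (p₀ q : Func d K) (z : Obs d K) : ℝ := truncLog B (p₀ z.1 z.2) (q z.1 z.2)

/-- The truncated risk of a fixed `q`: the mean of its truncated log-likelihood ratio. -/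
def meanRatio (P : Measure (Obs d K)) (B : ℝ) (p₀ q : Func d K) : ℝ := ∫ z, obsRatio B p₀ q z ∂P

/-- The empirical mean of the truncated log-likelihood ratio of `q`. -/
def empRatio (B : ℝ) (p₀ q : Func d K) (D : Data n d K) : ℝ :=
  (n : ℝ)⁻¹ * ∑ i, obsRatio B p₀ q (D i)

variable {B : ℝ} {q : Func d K}

lemma measurable_obsRatio (hp₀ : IsTrueProb P p₀) (hq : Measurable q) :
    Measurable (obsRatio B p₀ q) :=
  (measurable_truncLog B).comp
    ((measurable_uncurry_label hp₀.1).prodMk (measurable_uncurry_label hq))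

lemma neg_mul_log_le_one {p : ℝ} (hp : 0 ≤ p) : p * -Real.log p ≤ 1 := by
  rcases hp.eq_or_lt with rfl | hp
  · simp
  · have := Real.one_sub_inv_le_log_of_pos hp
    have h2 := mul_le_mul_of_nonneg_left this hp.le
    rw [mul_sub, mul_inv_cancel₀ hp.ne'] at h2
    linarith

lemma mul_abs_obsRatio_le (hp₀ : IsTrueProb P p₀) (hB : 0 ≤ B)
    (hq : ∀ x, q x ∈ stdSimplex ℝ (Fin K)) (x : Cube d) (k : Fin K) :
    p₀ x k * |obsRatio B p₀ q (x, k)| ≤ B + 1 := by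
  have h0 := (hp₀.2.1 x).1 k
  have h1 := le_one_of_mem_stdSimplex (hp₀.2.1 x) k
  have h2 : |obsRatio B p₀ q (x, k)| ≤ B + -Real.log (p₀ x k) := by
    have hl := Real.log_nonpos h0 h1
    have hu := truncLog_le (q := q x k) hB h0
    have hd := log_le_truncLog hB h0 h1 (le_one_of_mem_stdSimplex (hq x) k)
    exact abs_le.2 ⟨by simp only [obsRatio]; linarith, by simp only [obsRatio]; linarith⟩
  have h3 := mul_le_mul_of_nonneg_left h2 h0
  have h4 := neg_mul_log_le_one h0
  nlinarith

lemma measurable_sum_mul_truncLog {α : Type*} [MeasurableSpace α] {u v : α → Fin K → ℝ}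
    (hu : Measurable u) (hv : Measurable v) :
    Measurable fun x => ∑ k, u x k * truncLog B (u x k) (v x k) := by
  refine Finset.measurable_sum _ fun k _ => ?_
  have h1 : Measurable fun x => u x k := (measurable_pi_apply k).comp hu
  have h2 : Measurable fun x => v x k := (measurable_pi_apply k).comp hv
  exact h1.mul ((measurable_truncLog B).comp (h1.prodMk h2))

lemma mul_exp_neg_obsRatio_le {s : ℝ} (hs0 : 0 ≤ s) (hs1 : s ≤ 1) (hp₀ : IsTrueProb P p₀)
    (hB : 0 ≤ B) (hq : ∀ x, q x ∈ stdSimplex ℝ (Fin K)) (x : Cube d) (k : Fin K) :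
    p₀ x k * |Real.exp (-(s * obsRatio B p₀ q (x, k)))| ≤ 2 := by
  have h0 := (hp₀.2.1 x).1 k
  have h1 := le_one_of_mem_stdSimplex (hp₀.2.1 x) k
  rw [abs_of_pos (Real.exp_pos _)]
  have hs : Real.exp (-(s * obsRatio B p₀ q (x, k))) ≤
      1 + Real.exp (-obsRatio B p₀ q (x, k)) := by
    rcases le_total 0 (obsRatio B p₀ q (x, k)) with h | h
    · have : Real.exp (-(s * obsRatio B p₀ q (x, k))) ≤ 1 :=
        Real.exp_le_one_iff.2 (by nlinarith)
      linarith [Real.exp_pos (-obsRatio B p₀ q (x, k))]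
    · have : Real.exp (-(s * obsRatio B p₀ q (x, k))) ≤ Real.exp (-obsRatio B p₀ q (x, k)) :=
        Real.exp_le_exp.2 (by nlinarith)
      linarith
  have h2 : p₀ x k * Real.exp (-obsRatio B p₀ q (x, k)) ≤ 1 := by
    rcases h0.eq_or_lt with h | h
    · rw [← h]; simp
    · rw [obsRatio, mul_exp_neg_truncLog h]
      exact max_le (le_one_of_mem_stdSimplex (hq x) k)
        (mul_le_one₀ h1 (Real.exp_pos _).le (Real.exp_le_one_iff.2 (by linarith)))
  have := mul_le_mul_of_nonneg_left hs h0
  linarith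

/-! ### Integrals and the exponential deviation inequality -/

section

variable [IsProbabilityMeasure P]

lemma integrable_obs (hp₀ : IsTrueProb P p₀) {h : Obs d K → ℝ} (hh : Measurable h) {c : ℝ}
    (hc : ∀ x k, p₀ x k * |h (x, k)| ≤ c) : Integrable h P := by
  refine ⟨hh.aestronglyMeasurable, ?_⟩
  rw [hasFiniteIntegral_iff_norm, lintegral_obs hp₀ hh.norm.ennreal_ofReal]
  calc ∫⁻ x, ∑ k, ENNReal.ofReal (p₀ x k) * ENNReal.ofReal ‖h (x, k)‖ ∂P.fst
      ≤ ∫⁻ _, ∑ _k : Fin K, ENNReal.ofReal c ∂P.fst := by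
        refine lintegral_mono fun x => Finset.sum_le_sum fun k _ => ?_
        rw [← ENNReal.ofReal_mul ((hp₀.2.1 x).1 k)]
        exact ENNReal.ofReal_le_ofReal (hc x k)
    _ < ⊤ := by
        rw [lintegral_const]
        simp [ENNReal.mul_lt_top]

lemma integral_obs (hp₀ : IsTrueProb P p₀) {h : Obs d K → ℝ} (hh : Measurable h) {c : ℝ}
    (hc : ∀ x k, p₀ x k * |h (x, k)| ≤ c) :
    ∫ z, h z ∂P = ∫ x, ∑ k, p₀ x k * h (x, k) ∂P.fst := by
  have hm (k : Fin K) : Measurable fun x : Cube d => h (x, k) := hh.comp measurable_prodMk_right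
  have hi := integrable_obs hp₀ hh hc
  have hi' (k : Fin K) : Integrable h
      ((P.fst.withDensity fun x => ENNReal.ofReal (p₀ x k)).map fun x => (x, k)) := by
    refine hi.mono_measure ?_
    conv_rhs => rw [hp₀.eq_sum_map]
    exact Finset.single_le_sum (f := fun k =>
      (P.fst.withDensity fun x => ENNReal.ofReal (p₀ x k)).map fun x => (x, k))
      (fun _ _ => Measure.zero_le _) (Finset.mem_univ k)
  conv_lhs => rw [hp₀.eq_sum_map]
  rw [integral_finsetSum_measure fun k _ => hi' k, integral_finsetSum]
  · refine Finset.sum_congr rfl fun k _ => ?_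
    rw [integral_map measurable_prodMk_right.aemeasurable hh.aestronglyMeasurable,
      integral_withDensity_eq_integral_toReal_smul (measurable_prob hp₀ k).ennreal_ofReal
        (by simp)]
    exact integral_congr_ae (Filter.Eventually.of_forall fun x => by
      simp [ENNReal.toReal_ofReal ((hp₀.2.1 x).1 k)])
  · intro k _
    refine Integrable.of_bound ((measurable_prob hp₀ k).mul (hm k)).aestronglyMeasurable c
      (Filter.Eventually.of_forall fun x => ?_)
    rw [norm_mul, Real.norm_of_nonneg ((hp₀.2.1 x).1 k)]
    exact hc x k

lemma integrable_obsRatio (hp₀ : IsTrueProb P p₀) (hB : 0 ≤ B) (hq : Measurable q)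
    (hqs : ∀ x, q x ∈ stdSimplex ℝ (Fin K)) : Integrable (obsRatio B p₀ q) P :=
  integrable_obs hp₀ (measurable_obsRatio hp₀ hq) (mul_abs_obsRatio_le hp₀ hB hqs)

lemma meanRatio_eq (hp₀ : IsTrueProb P p₀) (hB : 0 ≤ B) (hq : Measurable q)
    (hqs : ∀ x, q x ∈ stdSimplex ℝ (Fin K)) :
    meanRatio P B p₀ q = ∫ x, ∑ k, p₀ x k * truncLog B (p₀ x k) (q x k) ∂P.fst :=
  integral_obs hp₀ (measurable_obsRatio hp₀ hq) (mul_abs_obsRatio_le hp₀ hB hqs)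

lemma integrable_exp_neg_obsRatio {s : ℝ} (hs0 : 0 ≤ s) (hs1 : s ≤ 1) (hp₀ : IsTrueProb P p₀)
    (hB : 0 ≤ B) (hq : Measurable q) (hqs : ∀ x, q x ∈ stdSimplex ℝ (Fin K)) :
    Integrable (fun z => Real.exp (-(s * obsRatio B p₀ q z))) P :=
  integrable_obs hp₀ (((measurable_obsRatio hp₀ hq).const_mul s).neg.exp)
    (mul_exp_neg_obsRatio_le hs0 hs1 hp₀ hB hqs)

/-- One observation: `𝔼 e^{-sL} ≤ e^{-(s - 2 s² B) 𝔼 L}`. -/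
lemma integral_exp_neg_obsRatio_le {s : ℝ} (hs0 : 0 ≤ s) (hs1 : s ≤ 1) (hp₀ : IsTrueProb P p₀)
    (hB : 2 ≤ B) (hq : Measurable q) (hqs : ∀ x, q x ∈ stdSimplex ℝ (Fin K)) :
    ∫ z, Real.exp (-(s * obsRatio B p₀ q z)) ∂P ≤
      Real.exp (-((s - 2 * s ^ 2 * B) * meanRatio P B p₀ q)) := by
  have hB0 : 0 ≤ B := by linarith
  have hρ : Integrable (fun x => ∑ k, p₀ x k * truncLog B (p₀ x k) (q x k)) P.fst := by
    refine Integrable.of_bound (measurable_sum_mul_truncLog hp₀.1 hq).aestronglyMeasurable B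
      (Filter.Eventually.of_forall fun x => ?_)
    rw [Real.norm_of_nonneg (sum_mul_truncLog_nonneg hB (hp₀.2.1 x) (hqs x))]
    exact sum_mul_truncLog_le hB0 (hp₀.2.1 x) (q x)
  have hm : Measurable fun z => Real.exp (-(s * obsRatio B p₀ q z)) :=
    ((measurable_obsRatio hp₀ hq).const_mul s).neg.exp
  rw [integral_obs hp₀ hm (mul_exp_neg_obsRatio_le hs0 hs1 hp₀ hB0 hqs)]
  calc ∫ x, ∑ k, p₀ x k * Real.exp (-(s * obsRatio B p₀ q (x, k))) ∂P.fst
      ≤ ∫ x, (1 - (s - 2 * s ^ 2 * B) *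
          ∑ k, p₀ x k * truncLog B (p₀ x k) (q x k)) ∂P.fst := by
        refine integral_mono_of_nonneg (Filter.Eventually.of_forall fun x =>
          Finset.sum_nonneg fun k _ => mul_nonneg ((hp₀.2.1 x).1 k) (Real.exp_pos _).le)
          ((integrable_const _).sub (hρ.const_mul _)) (Filter.Eventually.of_forall fun x => ?_)
        exact sum_mul_exp_neg_truncLog_le hs0 hs1 hB (hp₀.2.1 x) (hqs x)
    _ = 1 - (s - 2 * s ^ 2 * B) * meanRatio P B p₀ q := by
        rw [integral_sub (integrable_const _) (hρ.const_mul _), integral_const_mul,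
          meanRatio_eq hp₀ hB0 hq hqs]
        simp
    _ ≤ _ := by
        have := Real.add_one_le_exp (-((s - 2 * s ^ 2 * B) * meanRatio P B p₀ q))
        linarith

instance : IsProbabilityMeasure (dataLaw n P) := by unfold dataLaw; infer_instance

lemma integrable_exp_deviation {lam s : ℝ} (hs0 : 0 ≤ s) (hs1 : s ≤ 1)
    (hp₀ : IsTrueProb P p₀) (hB : 0 ≤ B) (hq : Measurable q)
    (hqs : ∀ x, q x ∈ stdSimplex ℝ (Fin K)) :
    Integrable (fun D : Data n d K =>
      Real.exp (lam * meanRatio P B p₀ q - s * ∑ i, obsRatio B p₀ q (D i))) (dataLaw n P) := by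
  have h : Integrable (fun D : Data n d K => ∏ i, Real.exp (-(s * obsRatio B p₀ q (D i))))
      (dataLaw n P) :=
    Integrable.fintype_prod fun _ => integrable_exp_neg_obsRatio hs0 hs1 hp₀ hB hq hqs
  refine (h.const_mul (Real.exp (lam * meanRatio P B p₀ q))).congr
    (Filter.Eventually.of_forall fun D => ?_)
  simp only
  rw [← Real.exp_sum, ← Real.exp_add, Finset.sum_neg_distrib, ← Finset.mul_sum, sub_eq_add_neg]

/-- The exponential deviation inequality for one candidate. -/
lemma integral_exp_deviation_le {s : ℝ} (hs0 : 0 ≤ s) (hs1 : s ≤ 1)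
    (hp₀ : IsTrueProb P p₀) (hB : 2 ≤ B) (hq : Measurable q)
    (hqs : ∀ x, q x ∈ stdSimplex ℝ (Fin K)) :
    ∫ D : Data n d K, Real.exp (n * (s - 2 * s ^ 2 * B) * meanRatio P B p₀ q -
      s * ∑ i, obsRatio B p₀ q (D i)) ∂(dataLaw n P) ≤ 1 := by
  have h (D : Data n d K) : Real.exp (n * (s - 2 * s ^ 2 * B) * meanRatio P B p₀ q -
      s * ∑ i, obsRatio B p₀ q (D i)) =
      Real.exp (n * (s - 2 * s ^ 2 * B) * meanRatio P B p₀ q) *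
        ∏ i, Real.exp (-(s * obsRatio B p₀ q (D i))) := by
    rw [← Real.exp_sum, ← Real.exp_add, Finset.sum_neg_distrib, ← Finset.mul_sum, sub_eq_add_neg]
  simp_rw [h]
  rw [integral_const_mul, dataLaw,
    integral_fintype_prod_eq_pow (fun z => Real.exp (-(s * obsRatio B p₀ q z))), Fintype.card_fin]
  have h1 := pow_le_pow_left₀ (integral_nonneg fun z => (Real.exp_pos _).le)
    (integral_exp_neg_obsRatio_le hs0 hs1 hp₀ hB hq hqs) n
  rw [← Real.exp_nat_mul] at h1
  calc _ ≤ Real.exp (n * (s - 2 * s ^ 2 * B) * meanRatio P B p₀ q) *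
        Real.exp (n * -((s - 2 * s ^ 2 * B) * meanRatio P B p₀ q)) :=
        mul_le_mul_of_nonneg_left h1 (Real.exp_pos _).le
    _ = 1 := by
        rw [← Real.exp_add, Real.exp_eq_one_iff]
        ring

end

end

noncomputable section

variable {n d K : ℕ} {P : Measure (Obs d K)} {p₀ q : Func d K} {F : Set (Func d K)}
  {phat : Data n d K → Func d K} {B c : ℝ}

/-! ### Rare classes and entropy -/

/-- The cost of rare classes at an observation; it does not depend on any candidate. -/
def obsCost (B c : ℝ) (p₀ : Func d K) (z : Obs d K) : ℝ := smallProbCost B c (p₀ z.1 z.2)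

/-- The negative log-likelihood of the true class probabilities at an observation; its mean is
the conditional entropy of `Y` given `X`. -/
def obsEntropy (p₀ : Func d K) (z : Obs d K) : ℝ := -Real.log (p₀ z.1 z.2)

lemma measurable_obsCost (hp₀ : IsTrueProb P p₀) : Measurable (obsCost B c p₀) :=
  (measurable_smallProbCost B c).comp (measurable_uncurry_label hp₀.1)

lemma measurable_obsEntropy (hp₀ : IsTrueProb P p₀) : Measurable (obsEntropy p₀) :=
  (measurable_uncurry_label hp₀.1).log.neg

lemma obsEntropy_nonneg (hp₀ : IsTrueProb P p₀) (z : Obs d K) : 0 ≤ obsEntropy p₀ z :=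
  neg_nonneg.2 <| Real.log_nonpos ((hp₀.2.1 z.1).1 z.2) (le_one_of_mem_stdSimplex (hp₀.2.1 z.1) z.2)

lemma mul_abs_obsCost_le (hp₀ : IsTrueProb P p₀) (hB : 0 ≤ B) (hc : 0 < c)
    (hce : c ≤ Real.exp (-1)) (x : Cube d) (k : Fin K) :
    p₀ x k * |obsCost B c p₀ (x, k)| ≤ c * (B - Real.log c) := by
  rw [obsCost, abs_of_nonneg (smallProbCost_nonneg hB ((hp₀.2.1 x).1 k)
    (le_one_of_mem_stdSimplex (hp₀.2.1 x) k))]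
  exact mul_smallProbCost_le hB hc hce ((hp₀.2.1 x).1 k)

lemma mul_abs_obsEntropy_le (hp₀ : IsTrueProb P p₀) (x : Cube d) (k : Fin K) :
    p₀ x k * |obsEntropy p₀ (x, k)| ≤ 1 := by
  rw [abs_of_nonneg (obsEntropy_nonneg hp₀ _)]
  exact neg_mul_log_le_one ((hp₀.2.1 x).1 k)

lemma abs_obsRatio_le (hp₀ : IsTrueProb P p₀) (hB : 0 ≤ B) {z : Obs d K}
    (hq : q z.1 ∈ stdSimplex ℝ (Fin K)) :
    |obsRatio B p₀ q z| ≤ B + obsEntropy p₀ z := by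
  have h0 := (hp₀.2.1 z.1).1 z.2
  have hu := truncLog_le (q := q z.1 z.2) hB h0
  have hd := log_le_truncLog hB h0 (le_one_of_mem_stdSimplex (hp₀.2.1 z.1) z.2)
    (le_one_of_mem_stdSimplex hq z.2)
  have he := obsEntropy_nonneg hp₀ z
  simp only [obsRatio, obsEntropy] at *
  exact abs_le.2 ⟨by linarith, by linarith⟩

/-- Two candidates that are close after clipping at `c e^{-B}` have close ratios, up to the cost of
rare classes. -/
lemma obsRatio_sub_le {δ : ℝ} {q' : Func d K} (hp₀ : IsTrueProb P p₀) (hB : 0 ≤ B) (hc : 0 < c)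
    (hδ : 0 ≤ δ) (hq' : ∀ x, q' x ∈ stdSimplex ℝ (Fin K))
    (h : ∀ x k, |max (c * Real.exp (-B)) (q x k) - max (c * Real.exp (-B)) (q' x k)| ≤
      δ * (c * Real.exp (-B))) (z : Obs d K) :
    obsRatio B p₀ q z - obsRatio B p₀ q' z ≤ δ + obsCost B c p₀ z :=
  truncLog_sub_le hB hc hδ ((hp₀.2.1 z.1).1 z.2) (le_one_of_mem_stdSimplex (hp₀.2.1 z.1) z.2)
    (le_one_of_mem_stdSimplex (hq' z.1) z.2) (h z.1 z.2)

lemma measurable_obsRatio_estimator (hp₀ : IsTrueProb P p₀) (hphat : IsEstimator F phat)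
    (i : Fin n) : Measurable fun D : Data n d K => obsRatio B p₀ (phat D) (D i) := by
  have h1 : Measurable fun D : Data n d K => ((D, (D i).1), (D i).2) := by fun_prop
  have h2 : Measurable fun D : Data n d K => phat D (D i).1 (D i).2 :=
    (measurable_uncurry_label hphat.2).comp h1
  have h3 : Measurable fun D : Data n d K => p₀ (D i).1 (D i).2 :=
    (measurable_uncurry_label hp₀.1).comp (measurable_pi_apply i)
  exact (measurable_truncLog B).comp (h3.prodMk h2)

lemma empLoss_eq (p : Func d K) (D : Data n d K) :
    empLoss p D = (n : ℝ≥0∞)⁻¹ * ∑ i, (-elog (p (D i).1 (D i).2)).toENNReal := by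
  unfold empLoss oneHot
  congr 1
  refine Finset.sum_congr rfl fun i _ => ?_
  rw [Finset.sum_eq_single (D i).2] <;> simp +contextual

lemma measurable_neg_elog : Measurable fun r : ℝ => (-elog r).toENNReal := by
  unfold elog
  fun_prop

section

variable [IsProbabilityMeasure P]

lemma integrable_obsCost (hp₀ : IsTrueProb P p₀) (hB : 0 ≤ B) (hc : 0 < c)
    (hce : c ≤ Real.exp (-1)) : Integrable (obsCost B c p₀) P :=
  integrable_obs hp₀ (measurable_obsCost hp₀) (mul_abs_obsCost_le hp₀ hB hc hce)

lemma integrable_obsEntropy (hp₀ : IsTrueProb P p₀) : Integrable (obsEntropy p₀) P :=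
  integrable_obs hp₀ (measurable_obsEntropy hp₀) (mul_abs_obsEntropy_le hp₀)

lemma integral_obsCost_le (hp₀ : IsTrueProb P p₀) (hB : 0 ≤ B) (hc : 0 < c)
    (hce : c ≤ Real.exp (-1)) : ∫ z, obsCost B c p₀ z ∂P ≤ K * (c * (B - Real.log c)) := by
  rw [integral_obs hp₀ (measurable_obsCost hp₀) (mul_abs_obsCost_le hp₀ hB hc hce)]
  calc ∫ x, ∑ k, p₀ x k * obsCost B c p₀ (x, k) ∂P.fst
      ≤ ∫ _, (K * (c * (B - Real.log c))) ∂P.fst := by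
        refine integral_mono_of_nonneg (Filter.Eventually.of_forall fun x =>
          Finset.sum_nonneg fun k _ => mul_nonneg ((hp₀.2.1 x).1 k)
            (smallProbCost_nonneg hB ((hp₀.2.1 x).1 k)
              (le_one_of_mem_stdSimplex (hp₀.2.1 x) k)))
          (integrable_const _) (Filter.Eventually.of_forall fun x => ?_)
        calc ∑ k, p₀ x k * obsCost B c p₀ (x, k) ≤ ∑ _k : Fin K, c * (B - Real.log c) :=
              Finset.sum_le_sum fun k _ => mul_smallProbCost_le hB hc hce ((hp₀.2.1 x).1 k)
          _ = K * (c * (B - Real.log c)) := by simp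
    _ = _ := by simp

/-! ### Empirical means -/

lemma integrable_empMean {f : Obs d K → ℝ} (hf : Integrable f P) :
    Integrable (fun D : Data n d K => (n : ℝ)⁻¹ * ∑ i, f (D i)) (dataLaw n P) :=
  (integrable_finsetSum _ fun _ _ => integrable_comp_eval hf).const_mul _

lemma integral_empMean (hn : n ≠ 0) {f : Obs d K → ℝ} (hf : Integrable f P) :
    ∫ D : Data n d K, (n : ℝ)⁻¹ * ∑ i, f (D i) ∂(dataLaw n P) = ∫ z, f z ∂P := by
  rw [dataLaw, integral_const_mul, integral_finsetSum _ fun i _ => integrable_comp_eval hf]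
  simp_rw [integral_comp_eval (μ := fun _ : Fin n => P) hf.aestronglyMeasurable]
  simp [hn]

lemma lintegral_empMean (hn : n ≠ 0) {f : Obs d K → ℝ≥0∞} (hf : Measurable f) :
    ∫⁻ D : Data n d K, (n : ℝ≥0∞)⁻¹ * ∑ i, f (D i) ∂(dataLaw n P) = ∫⁻ z, f z ∂P := by
  have hi (i : Fin n) : ∫⁻ D : Data n d K, f (D i) ∂(dataLaw n P) = ∫⁻ z, f z ∂P :=
    (measurePreserving_eval (fun _ : Fin n => P) i).lintegral_comp hf
  rw [lintegral_const_mul _ (by fun_prop), lintegral_finsetSum _ (by fun_prop)]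
  simp only [hi, Finset.sum_const, Finset.card_univ, Fintype.card_fin, nsmul_eq_mul]
  rw [← mul_assoc, ENNReal.inv_mul_cancel (by exact_mod_cast hn) (ENNReal.natCast_ne_top n),
    one_mul]

/-! ### The risk and the empirical ratio of the estimator -/

lemma integrable_empRatio_estimator (hp₀ : IsTrueProb P p₀) (hF : IsProbClass F)
    (hphat : IsEstimator F phat) (hB : 0 ≤ B) :
    Integrable (fun D => empRatio B p₀ (phat D) D) (dataLaw n P) := by
  refine (integrable_finsetSum _ fun i _ => ?_).const_mul _
  refine Integrable.mono' (g := fun D : Data n d K => B + obsEntropy p₀ (D i))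
    ((integrable_const B).add (integrable_comp_eval (integrable_obsEntropy hp₀)))
    (measurable_obsRatio_estimator hp₀ hphat i).aestronglyMeasurable
    (Filter.Eventually.of_forall fun D => ?_)
  exact abs_obsRatio_le hp₀ hB ((hF _ (hphat.1 D)).2 _)

lemma integrable_truncKL_estimator (hp₀ : IsTrueProb P p₀) (hF : IsProbClass F)
    (hphat : IsEstimator F phat) (hB : 2 ≤ B) :
    Integrable (fun z : Data n d K × Cube d =>
      ∑ k, p₀ z.2 k * truncLog B (p₀ z.2 k) (phat z.1 z.2 k)) ((dataLaw n P).prod P.fst) := by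
  refine Integrable.of_bound (measurable_sum_mul_truncLog (hp₀.1.comp measurable_snd)
    hphat.2).aestronglyMeasurable B (Filter.Eventually.of_forall fun z => ?_)
  rw [Real.norm_of_nonneg (sum_mul_truncLog_nonneg hB (hp₀.2.1 z.2) ((hF _ (hphat.1 z.1)).2 z.2))]
  exact sum_mul_truncLog_le (by linarith) (hp₀.2.1 z.2) _

lemma integrable_meanRatio_estimator (hp₀ : IsTrueProb P p₀) (hF : IsProbClass F)
    (hphat : IsEstimator F phat) (hB : 2 ≤ B) :
    Integrable (fun D => meanRatio P B p₀ (phat D)) (dataLaw n P) :=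
  (integrable_truncKL_estimator hp₀ hF hphat hB).integral_prod_left.congr <|
    Filter.Eventually.of_forall fun D => (meanRatio_eq hp₀ (by linarith)
      (hF _ (hphat.1 D)).1 (hF _ (hphat.1 D)).2).symm

lemma truncRisk_eq (hp₀ : IsTrueProb P p₀) (hF : IsProbClass F)
    (hphat : IsEstimator F phat) (hB : 2 ≤ B) :
    truncRisk P B p₀ phat = ENNReal.ofReal (∫ D, meanRatio P B p₀ (phat D) ∂(dataLaw n P)) := by
  have hi := integrable_truncKL_estimator (n := n) hp₀ hF hphat hB
  have h1 : ∫ D, meanRatio P B p₀ (phat D) ∂(dataLaw n P) =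
      ∫ z : Data n d K × Cube d, ∑ k, p₀ z.2 k * truncLog B (p₀ z.2 k) (phat z.1 z.2 k)
        ∂((dataLaw n P).prod P.fst) := by
    rw [integral_prod _ hi]
    exact integral_congr_ae <| Filter.Eventually.of_forall fun D => meanRatio_eq hp₀ (by linarith)
      (hF _ (hphat.1 D)).1 (hF _ (hphat.1 D)).2
  rw [h1, ofReal_integral_eq_lintegral_ofReal hi (Filter.Eventually.of_forall fun z =>
    sum_mul_truncLog_nonneg hB (hp₀.2.1 z.2) ((hF _ (hphat.1 z.1)).2 z.2)), truncRisk]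
  exact lintegral_congr fun z => toENNReal_truncKL (hp₀.2.1 z.2) ((hF _ (hphat.1 z.1)).2 z.2)

/-! ### Uniform deviation over a net -/

/-- The deviation inequality for the estimator. The net element close to the estimate depends on
the data, so the maximum over the net is bounded by a normalized sum of exponentials, whose mean is
at most one. -/
lemma integral_meanRatio_le (hn : n ≠ 0) (hp₀ : IsTrueProb P p₀) (hF : IsProbClass F)
    (hphat : IsEstimator F phat) (hB : 2 ≤ B) {δ ε : ℝ} (hδ : 0 ≤ δ) (hε : 0 < ε)
    (hc : 0 < c) (hce : c ≤ Real.exp (-1)) (T : Finset (Func d K)) (hTF : ∀ q ∈ T, q ∈ F)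
    (hT : ∀ p ∈ F, ∃ q ∈ T, ∀ x k,
      |max (c * Real.exp (-B)) (p x k) - max (c * Real.exp (-B)) (q x k)| ≤
        δ * (c * Real.exp (-B))) :
    ∫ D, meanRatio P B p₀ (phat D) ∂(dataLaw n P) ≤
      (1 + ε) * ∫ D, empRatio B p₀ (phat D) D ∂(dataLaw n P) +
        (2 + ε) * (δ + K * (c * (B - Real.log c))) +
        (1 + ε) ^ 2 / ε * (2 * B * Real.log T.card / n) := by
  have hB0 : 0 ≤ B := by linarith
  have hn0 : (0 : ℝ) < n := by positivity
  -- this `s` balances the two terms of the exponent: `s - 2 s² B = s / (1 + ε)`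
  set s : ℝ := ε / (2 * B * (1 + ε)) with hs
  have hs0 : 0 < s := by positivity
  have hs1 : s ≤ 1 := by
    rw [hs, div_le_one (by positivity)]
    nlinarith
  have hsB : s - 2 * s ^ 2 * B = s / (1 + ε) := by
    rw [hs]; field_simp; ring
  set lam : ℝ := n * (s / (1 + ε)) with hlam
  have hlam0 : 0 < lam := by positivity
  have hq (q : Func d K) (h : q ∈ T) := hF q (hTF q h)
  set E : Func d K → Data n d K → ℝ := fun q D =>
    Real.exp (n * (s - 2 * s ^ 2 * B) * meanRatio P B p₀ q - s * ∑ i, obsRatio B p₀ q (D i)) with hE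
  have hEint (q : Func d K) (h : q ∈ T) : Integrable (E q) (dataLaw n P) :=
    integrable_exp_deviation hs0.le hs1 hp₀ hB0 (hq q h).1 (hq q h).2
  set S : Data n d K → ℝ := fun D => ∑ q ∈ T, E q D with hS
  have hSint : Integrable S (dataLaw n P) := integrable_finsetSum _ hEint
  have hSle : ∫ D, S D ∂(dataLaw n P) ≤ T.card := by
    rw [hS, integral_finsetSum _ hEint]
    calc _ ≤ ∑ q ∈ T, (1 : ℝ) := Finset.sum_le_sum fun q h =>
          integral_exp_deviation_le hs0.le hs1 hp₀ hB (hq q h).1 (hq q h).2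
      _ = T.card := by simp
  set b : ℝ := ∫ z, obsCost B c p₀ z ∂P with hb
  set A : Data n d K → ℝ := fun D => (n : ℝ)⁻¹ * ∑ i, obsCost B c p₀ (D i) with hA
  have hcost := integrable_obsCost hp₀ hB0 hc hce
  obtain ⟨D₀⟩ : Nonempty (Data n d K) := (dataLaw n P).nonempty_of_neZero
  have hT0 : 0 < T.card := by
    obtain ⟨q, hqT, -⟩ := hT _ (hphat.1 D₀)
    exact Finset.card_pos.2 ⟨q, hqT⟩
  have hTr : (0 : ℝ) < T.card := by exact_mod_cast hT0
  have key (D : Data n d K) : meanRatio P B p₀ (phat D) ≤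
      (1 + ε) * empRatio B p₀ (phat D) D + ((2 + ε) * δ + b) + (1 + ε) * A D +
        lam⁻¹ * (Real.log T.card + (S D / T.card - 1)) := by
    obtain ⟨q, hqT, hclose⟩ := hT _ (hphat.1 D)
    have hph := hF _ (hphat.1 D)
    have h1 : meanRatio P B p₀ (phat D) ≤ meanRatio P B p₀ q + (δ + b) := by
      have hi1 := integrable_obsRatio hp₀ hB0 hph.1 hph.2
      have hi2 := integrable_obsRatio hp₀ hB0 (hq q hqT).1 (hq q hqT).2
      have h : ∫ z, obsRatio B p₀ (phat D) z ∂P ≤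
          ∫ z, (obsRatio B p₀ q z + (δ + obsCost B c p₀ z)) ∂P :=
        integral_mono hi1 (hi2.add ((integrable_const δ).add hcost)) fun z => by
          have := obsRatio_sub_le hp₀ hB0 hc hδ (hq q hqT).2 hclose z
          simp only
          linarith
      have hi3 : Integrable (fun z => δ + obsCost B c p₀ z) P := (integrable_const δ).add hcost
      rw [integral_add hi2 hi3, integral_add (integrable_const δ) hcost] at h
      simpa [meanRatio, hb] using h
    have h2 : empRatio B p₀ q D ≤ empRatio B p₀ (phat D) D + (δ + A D) := by
      have h : ∑ i, obsRatio B p₀ q (D i) ≤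
          ∑ i, (obsRatio B p₀ (phat D) (D i) + (δ + obsCost B c p₀ (D i))) :=
        Finset.sum_le_sum fun i _ => by
          have := obsRatio_sub_le (q := q) hp₀ hB0 hc hδ hph.2
            (fun x k => by rw [abs_sub_comm]; exact hclose x k) (D i)
          linarith
      have h' := mul_le_mul_of_nonneg_left h (inv_nonneg.2 hn0.le)
      rw [Finset.sum_add_distrib, Finset.sum_add_distrib, mul_add, mul_add] at h'
      simpa [empRatio, hA, hn] using h'
    have h3 : lam * (meanRatio P B p₀ q - (1 + ε) * empRatio B p₀ q D) ≤
        Real.log T.card + (S D / T.card - 1) := by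
      have hexp : Real.exp (lam * (meanRatio P B p₀ q - (1 + ε) * empRatio B p₀ q D)) ≤ S D := by
        have he : E q D =
            Real.exp (lam * (meanRatio P B p₀ q - (1 + ε) * empRatio B p₀ q D)) := by
          rw [hE]
          simp only
          rw [hsB, empRatio, hlam]
          congr 1
          field_simp
        rw [← he]
        exact Finset.single_le_sum (f := fun q => E q D) (fun q _ => (Real.exp_pos _).le) hqT
      have h := Real.add_one_le_exp
        (lam * (meanRatio P B p₀ q - (1 + ε) * empRatio B p₀ q D) - Real.log T.card)
      rw [Real.exp_sub, Real.exp_log hTr] at h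
      have h' := div_le_div_of_nonneg_right hexp hTr.le
      linarith
    have h4 : meanRatio P B p₀ q - (1 + ε) * empRatio B p₀ q D ≤
        lam⁻¹ * (Real.log T.card + (S D / T.card - 1)) := by
      rwa [inv_mul_eq_div, le_div_iff₀' hlam0]
    have h5 := mul_le_mul_of_nonneg_left h2 (by positivity : 0 ≤ 1 + ε)
    linarith
  have hi1 := (integrable_empRatio_estimator (n := n) hp₀ hF hphat hB0).const_mul (1 + ε)
  have hi2 : Integrable (fun D => (1 + ε) * empRatio B p₀ (phat D) D + ((2 + ε) * δ + b))
      (dataLaw n P) := hi1.add (integrable_const _)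
  have hA1 : Integrable A (dataLaw n P) := integrable_empMean hcost
  have hA2 : ∫ D, A D ∂(dataLaw n P) = b := integral_empMean hn hcost
  have hi3 : Integrable (fun D => (1 + ε) * empRatio B p₀ (phat D) D + ((2 + ε) * δ + b) +
      (1 + ε) * A D) (dataLaw n P) := hi2.add (hA1.const_mul _)
  have hS2 : Integrable (fun D => S D / T.card - 1) (dataLaw n P) :=
    (hSint.div_const _).sub (integrable_const _)
  have hi4 : Integrable (fun D => lam⁻¹ * (Real.log T.card + (S D / T.card - 1)))
      (dataLaw n P) :=
    ((integrable_const _).add hS2).const_mul _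
  have h := integral_mono (integrable_meanRatio_estimator hp₀ hF hphat hB) (hi3.add hi4) key
  have e1 : ∫ D, ((1 + ε) * empRatio B p₀ (phat D) D + ((2 + ε) * δ + b) + (1 + ε) * A D +
        lam⁻¹ * (Real.log T.card + (S D / T.card - 1))) ∂(dataLaw n P) =
      (1 + ε) * ∫ D, empRatio B p₀ (phat D) D ∂(dataLaw n P) + ((2 + ε) * δ + b) + (1 + ε) * b +
        lam⁻¹ * (Real.log T.card + ((∫ D, S D ∂(dataLaw n P)) / T.card - 1)) := by
    rw [integral_add hi3 hi4, integral_add hi2 (hA1.const_mul _),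
      integral_add hi1 (integrable_const _), integral_const_mul, integral_const_mul (1 + ε) A,
      hA2, integral_const_mul lam⁻¹, integral_add (integrable_const _) hS2,
      integral_sub (hSint.div_const _) (integrable_const _), integral_div]
    simp
  have h' := h.trans_eq e1
  have hb' : b ≤ K * (c * (B - Real.log c)) := integral_obsCost_le hp₀ hB0 hc hce
  have hS1 : (∫ D, S D ∂(dataLaw n P)) / T.card - 1 ≤ 0 := by
    rw [sub_nonpos, div_le_one hTr]; exact hSle
  have hfin : lam⁻¹ * (Real.log T.card + ((∫ D, S D ∂(dataLaw n P)) / T.card - 1)) ≤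
      (1 + ε) ^ 2 / ε * (2 * B * Real.log T.card / n) := by
    calc _ ≤ lam⁻¹ * Real.log T.card :=
          mul_le_mul_of_nonneg_left (by linarith) (inv_nonneg.2 hlam0.le)
      _ = _ := by
          rw [hlam, hs]; field_simp
  have hb2 := mul_le_mul_of_nonneg_left hb' (by positivity : 0 ≤ 2 + ε)
  linarith

/-! ### The empirical ratio and the optimization gap -/

/-- The empirical ratio of the estimator has mean at most `Δ_n(p₀, phat) + R(p₀, p)`, for every `p`
in the class. The entropy of the true probabilities is added on both sides so that all terms are
nonnegative. -/
lemma ofReal_integral_empRatio_le (hn : n ≠ 0) (hp₀ : IsTrueProb P p₀) (hF : IsProbClass F)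
    (hphat : IsEstimator F phat) (hB : 0 ≤ B) {p : Func d K} (hp : p ∈ F) :
    ENNReal.ofReal (∫ D, empRatio B p₀ (phat D) D ∂(dataLaw n P) + ∫ z, obsEntropy p₀ z ∂P) ≤
      optGap P F phat + risk P p₀ p + ENNReal.ofReal (∫ z, obsEntropy p₀ z ∂P) := by
  have hent := integrable_obsEntropy hp₀
  have hemp := integrable_empRatio_estimator (n := n) hp₀ hF hphat hB
  have hpt (D : Data n d K) (i : Fin n) :
      0 ≤ obsRatio B p₀ (phat D) (D i) + obsEntropy p₀ (D i) := by
    have := log_le_truncLog hB ((hp₀.2.1 (D i).1).1 (D i).2)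
      (le_one_of_mem_stdSimplex (hp₀.2.1 (D i).1) (D i).2)
      (le_one_of_mem_stdSimplex ((hF _ (hphat.1 D)).2 (D i).1) (D i).2)
    simp only [obsRatio, obsEntropy]
    linarith
  have hsum (D : Data n d K) :
      empRatio B p₀ (phat D) D + (n : ℝ)⁻¹ * ∑ i, obsEntropy p₀ (D i) =
        (n : ℝ)⁻¹ * ∑ i, (obsRatio B p₀ (phat D) (D i) + obsEntropy p₀ (D i)) := by
    rw [empRatio, ← mul_add, Finset.sum_add_distrib]
  have hlow (D : Data n d K) : ENNReal.ofReal (empRatio B p₀ (phat D) D +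
      (n : ℝ)⁻¹ * ∑ i, obsEntropy p₀ (D i)) ≤ empLoss (phat D) D := by
    rw [hsum, ENNReal.ofReal_mul (by positivity), ENNReal.ofReal_sum_of_nonneg fun i _ => hpt D i,
      ENNReal.ofReal_inv_of_pos (by positivity), ENNReal.ofReal_natCast, empLoss_eq]
    gcongr with i
    rw [obsEntropy, ← sub_eq_add_neg]
    exact ofReal_truncLog_sub_log_le ((hp₀.2.1 (D i).1).1 (D i).2)
      (((hF _ (hphat.1 D)).2 (D i).1).1 (D i).2)
  have hgap (D : Data n d K) : empLoss (phat D) D ≤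
      (empLoss (phat D) D - ⨅ p ∈ F, empLoss p D) + empLoss p D :=
    le_tsub_add.trans (add_le_add le_rfl (iInf₂_le p hp))
  have hml : Measurable fun z : Obs d K => (-elog (p z.1 z.2)).toENNReal :=
    measurable_neg_elog.comp (measurable_uncurry_label (hF p hp).1)
  have hloss : ∫⁻ D : Data n d K, empLoss p D ∂(dataLaw n P) ≤
      risk P p₀ p + ENNReal.ofReal (∫ z, obsEntropy p₀ z ∂P) := by
    simp_rw [empLoss_eq]
    rw [lintegral_empMean hn hml, lintegral_obs hp₀ hml,
      ofReal_integral_eq_lintegral_ofReal hent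
        (Filter.Eventually.of_forall (obsEntropy_nonneg hp₀)),
      lintegral_obs hp₀ (measurable_obsEntropy hp₀).ennreal_ofReal, risk, ← lintegral_add_right]
    · exact lintegral_mono fun x => crossEntropy_le (hp₀.2.1 x) ((hF p hp).2 x)
    · refine Finset.measurable_sum _ fun k _ => ?_
      exact (measurable_prob hp₀ k).ennreal_ofReal.mul
        ((measurable_obsEntropy hp₀).ennreal_ofReal.comp measurable_prodMk_right)
  have hmp : Measurable fun D : Data n d K => empLoss p D := by
    simp_rw [empLoss_eq]
    exact (Finset.measurable_sum _ fun i _ => hml.comp (measurable_pi_apply i)).const_mul _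
  have hint : ∫ D, empRatio B p₀ (phat D) D ∂(dataLaw n P) + ∫ z, obsEntropy p₀ z ∂P =
      ∫ D : Data n d K, (empRatio B p₀ (phat D) D + (n : ℝ)⁻¹ * ∑ i, obsEntropy p₀ (D i))
        ∂(dataLaw n P) := by
    rw [integral_add hemp (integrable_empMean hent), integral_empMean hn hent]
  have hadd : Integrable (fun D : Data n d K => empRatio B p₀ (phat D) D +
      (n : ℝ)⁻¹ * ∑ i, obsEntropy p₀ (D i)) (dataLaw n P) := hemp.add (integrable_empMean hent)
  rw [hint, ofReal_integral_eq_lintegral_ofReal hadd]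
  · calc _ ≤ ∫⁻ D : Data n d K, ((empLoss (phat D) D - ⨅ p ∈ F, empLoss p D) + empLoss p D)
          ∂(dataLaw n P) := lintegral_mono fun D => (hlow D).trans (hgap D)
      _ = optGap P F phat + ∫⁻ D : Data n d K, empLoss p D ∂(dataLaw n P) :=
          lintegral_add_right _ hmp
      _ ≤ _ := by
          rw [add_assoc]
          exact add_le_add le_rfl hloss
  · exact Filter.Eventually.of_forall fun D => by
      simp only [Pi.zero_apply]
      rw [hsum]
      exact mul_nonneg (by positivity) (Finset.sum_nonneg fun i _ => hpt D i)

end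

end

noncomputable section

/-! ### Covering numbers -/

variable {n d K : ℕ} {F : Set (Func d K)}

/-- A finite covering number is attained by a finite net inside the class; the bound on the extended
distance becomes a pointwise one. -/
lemma exists_finset_of_coverNum_ne_top {r τ : ℝ} (hr : 0 ≤ r) (h : coverNum r F τ ≠ ⊤) :
    ∃ T : Finset (Func d K), (∀ q ∈ T, q ∈ F) ∧ (T.card : ℕ∞) = coverNum r F τ ∧
      ∀ p ∈ F, ∃ q ∈ T, ∀ x k, |max τ (p x k) - max τ (q x k)| ≤ r := by
  let _ := truncPseudo d K τ
  obtain ⟨T, hTF, hfin, hcov, hcard⟩ := Metric.exists_set_encard_eq_coveringNumber h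
  refine ⟨hfin.toFinset, fun q hq => hTF (hfin.mem_toFinset.1 hq), ?_, fun p hp => ?_⟩
  · rw [← hfin.encard_eq_coe_toFinset_card]
    exact hcard
  · obtain ⟨q, hq, hpq⟩ := hcov hp
    refine ⟨q, hfin.mem_toFinset.2 hq, fun x k => ?_⟩
    have h1 : ENNReal.ofReal |max τ (p x k) - max τ (q x k)| ≤ ENNReal.ofReal r :=
      (le_iSup₂ (f := fun x k => ENNReal.ofReal |max τ (p x k) - max τ (q x k)|) x k).trans hpq
    exact (ENNReal.ofReal_le_ofReal_iff hr).1 h1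

lemma logNum_natCast {N : ℕ} (hN : 0 < N) : logNum N = ENNReal.ofReal (Real.log N) := by
  have : ((N : ℕ∞) : ℝ≥0∞) = ENNReal.ofReal N := by simp
  rw [logNum, this, ENNReal.log_ofReal_of_pos (by exact_mod_cast hN), EReal.real_coe_toENNReal]

lemma logNum_top : logNum ⊤ = ⊤ := by simp [logNum]

/-! ### The oracle inequality -/

variable {P : Measure (Obs d K)} [IsProbabilityMeasure P] {p₀ : Func d K}
  {phat : Data n d K → Func d K}

/-- The oracle inequality against a fixed competitor `p`, for a finite covering number `N`. -/
lemma truncRisk_le_of_mem (hn : n ≠ 0) (hp₀ : IsTrueProb P p₀) (hF : IsProbClass F)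
    (hphat : IsEstimator F phat) {B δ ε c : ℝ} (hB : 2 ≤ B) (hδ : 0 ≤ δ)
    (hε : ε ∈ Set.Ioc (0 : ℝ) 1) (hc : 0 < c) (hce : c ≤ Real.exp (-1))
    (T : Finset (Func d K)) (hTF : ∀ q ∈ T, q ∈ F)
    (hT : ∀ p ∈ F, ∃ q ∈ T, ∀ x k,
      |max (c * Real.exp (-B)) (p x k) - max (c * Real.exp (-B)) (q x k)| ≤
        δ * (c * Real.exp (-B))) {p : Func d K} (hp : p ∈ F) :
    truncRisk P B p₀ phat ≤
      ENNReal.ofReal (1 + ε) * (risk P p₀ p + optGap P F phat + ENNReal.ofReal (3 * δ)) +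
        ENNReal.ofReal ((1 + ε) ^ 2 / ε) * ENNReal.ofReal
          (2 * B * Real.log T.card / n + 3 / 2 * (K * (c * (B - Real.log c)))) := by
  obtain ⟨hε0, hε1⟩ := hε
  have hB0 : 0 ≤ B := by linarith
  set I := risk P p₀ p + optGap P F phat with hI
  rcases eq_or_ne I ⊤ with htop | htop
  · rw [htop, top_add, ENNReal.mul_top (by simpa using (by linarith : 0 < 1 + ε)), top_add]
    exact le_top
  have h1 := ofReal_integral_empRatio_le hn hp₀ hF hphat hB0 hp
  rw [add_comm (optGap P F phat), ← hI, ← ENNReal.ofReal_toReal htop] at h1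
  have hent : 0 ≤ ∫ z, obsEntropy p₀ z ∂P := integral_nonneg (obsEntropy_nonneg hp₀)
  have hItr : 0 ≤ I.toReal := ENNReal.toReal_nonneg
  rw [← ENNReal.ofReal_add hItr hent, ENNReal.ofReal_le_ofReal_iff (by positivity)] at h1
  have h1' : ∫ D, empRatio B p₀ (phat D) D ∂(dataLaw n P) ≤ I.toReal := by linarith
  have h2 := integral_meanRatio_le hn hp₀ hF hphat hB hδ hε0 hc hce T hTF hT
  have hlc : Real.log c ≤ -1 := by simpa using Real.log_le_log hc hce
  have hR : 0 ≤ K * (c * (B - Real.log c)) := by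
    have : 0 ≤ B - Real.log c := by linarith
    positivity
  have hlog : 0 ≤ Real.log T.card := Real.log_natCast_nonneg _
  rw [truncRisk_eq hp₀ hF hphat hB, ← ENNReal.ofReal_toReal htop,
    ← ENNReal.ofReal_add hItr (by positivity), ← ENNReal.ofReal_mul (by positivity),
    ← ENNReal.ofReal_mul (by positivity), ← ENNReal.ofReal_add (by positivity) (by positivity)]
  refine ENNReal.ofReal_le_ofReal (h2.trans ?_)
  have h3 := mul_le_mul_of_nonneg_left h1' (by linarith : 0 ≤ 1 + ε)
  have h4 : (2 + ε) * δ ≤ (1 + ε) * (3 * δ) := by nlinarith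
  have h5 : (2 + ε) * (K * (c * (B - Real.log c))) ≤
      (1 + ε) ^ 2 / ε * (3 / 2 * (K * (c * (B - Real.log c)))) := by
    rw [← mul_assoc ((1 + ε) ^ 2 / ε)]
    refine mul_le_mul_of_nonneg_right ?_ hR
    rw [div_mul_eq_mul_div, le_div_iff₀ hε0]
    nlinarith
  linarith

end

end OracleCE

theorem mainTheorem5 {n d K : ℕ} (hK : 2 ≤ K)
    (P : Measure (OracleCE.Obs d K)) [IsProbabilityMeasure P]
    (p₀ : OracleCE.Func d K) (hp₀ : OracleCE.IsTrueProb P p₀)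
    (F : Set (OracleCE.Func d K)) (hF : OracleCE.IsProbClass F)
    (phat : OracleCE.Data n d K → OracleCE.Func d K) (hphat : OracleCE.IsEstimator F phat)
    (B δ ε C : ℝ) (hB : 2 ≤ B) (hδ : δ ∈ Set.Ioc (0 : ℝ) 1) (hε : ε ∈ Set.Ioc (0 : ℝ) 1)
    (hC : 0 < C) (hCn : C ≤ n * Real.exp (-1))
    (τ : ℝ) (hτ : τ = C * Real.exp (-B) / n)
    (hN : 3 ≤ OracleCE.coverNumE δ (OracleCE.logClass F) (Real.log τ) ∨
      3 ≤ OracleCE.coverNum (δ * C * Real.exp (-B) / n) F τ) :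
    OracleCE.truncRisk P B p₀ phat ≤
      ENNReal.ofReal (1 + ε) *
          ((⨅ p ∈ F, OracleCE.risk P p₀ p) + OracleCE.optGap P F phat + ENNReal.ofReal (3 * δ)) +
        ENNReal.ofReal ((1 + ε) ^ 2 / ε) *
          ((ENNReal.ofReal (68 * B) *
                OracleCE.logNum (OracleCE.coverNum (δ * C * Real.exp (-B) / n) F τ) +
              ENNReal.ofReal (272 * B + 3 / 2 * C * K * (Real.log (n / C) + B))) / n) := by
  have hn : n ≠ 0 := by
    rintro rfl
    simp at hCn
    linarith
  have hn0 : (0 : ℝ) < n := by positivity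
  have hε0 : 0 < ε := hε.1
  have hδ0 : 0 < δ := hδ.1
  have hcoef : 0 < (1 + ε) ^ 2 / ε := by positivity
  rcases eq_or_ne (OracleCE.coverNum (δ * C * Real.exp (-B) / n) F τ) ⊤ with htop | htop
  · -- an infinite covering number makes the right-hand side infinite
    rw [htop, OracleCE.logNum_top, ENNReal.mul_top (by simp; linarith), top_add,
      ENNReal.top_div_of_ne_top (ENNReal.natCast_ne_top n), ENNReal.mul_top (by simpa using hcoef),
      add_top]
    exact le_top
  obtain ⟨T, hTF, hcard, hT⟩ := OracleCE.exists_finset_of_coverNum_ne_top (by positivity) htop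
  -- classes of probability below `C / n` are the rare ones; `τ` is this threshold times `e^{-B}`
  have hc : 0 < C / n := by positivity
  have hce : C / n ≤ Real.exp (-1) := by rwa [div_le_iff₀' hn0]
  have hτ' : τ = C / n * Real.exp (-B) := by rw [hτ]; ring
  have hT' : ∀ p ∈ F, ∃ q ∈ T, ∀ x k, |max (C / n * Real.exp (-B)) (p x k) -
      max (C / n * Real.exp (-B)) (q x k)| ≤ δ * (C / n * Real.exp (-B)) := by
    intro p hp
    obtain ⟨q, hq, h⟩ := hT p hp
    refine ⟨q, hq, fun x k => ?_⟩
    have := h x k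
    rw [hτ'] at this
    exact this.trans_eq (by ring)
  obtain ⟨D₀⟩ : Nonempty (OracleCE.Data n d K) := (OracleCE.dataLaw n P).nonempty_of_neZero
  have hFne : (phat D₀) ∈ F := hphat.1 D₀
  have hT0 : 0 < T.card := by
    obtain ⟨q, hq, -⟩ := hT _ hFne
    exact Finset.card_pos.2 ⟨q, hq⟩
  have hlog : 0 ≤ Real.log T.card := Real.log_natCast_nonneg _
  have hlogc : -Real.log (C / n) = Real.log (n / C) := by rw [← Real.log_inv, inv_div]
  have hlc : Real.log (C / n) ≤ -1 := by simpa using Real.log_le_log hc hce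
  have hrem : 0 ≤ 3 / 2 * C * K * (Real.log (n / C) + B) := by
    have : 0 ≤ Real.log (n / C) + B := by linarith
    positivity
  rw [← hcard, OracleCE.logNum_natCast hT0, ← ENNReal.ofReal_mul (by positivity),
    ← ENNReal.ofReal_add (by positivity) (by positivity), ← ENNReal.ofReal_natCast n,
    ← ENNReal.ofReal_div_of_pos hn0]
  have hbound : 2 * B * Real.log T.card / n +
      3 / 2 * (K * (C / n * (B - Real.log (C / n)))) ≤
      (68 * B * Real.log T.card + (272 * B + 3 / 2 * C * K * (Real.log (n / C) + B))) / n := by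
    rw [sub_eq_add_neg, hlogc, le_div_iff₀ hn0]
    have : (2 * B * Real.log T.card / n + 3 / 2 * (K * (C / n * (B + Real.log (n / C))))) * n =
        2 * (B * Real.log T.card) + 3 / 2 * C * K * (Real.log (n / C) + B) := by
      field_simp
      ring
    rw [this]
    have : 0 ≤ B * Real.log T.card := by positivity
    linarith
  have hmem (p : F) := (OracleCE.truncRisk_le_of_mem hn hp₀ hF hphat hB hδ0.le hε hc hce T hTF
    hT' p.2).trans (add_le_add le_rfl (mul_le_mul_right (ENNReal.ofReal_le_ofReal hbound) _))
  have : Nonempty F := ⟨⟨_, hFne⟩⟩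
  rw [iInf_subtype', ENNReal.iInf_add, ENNReal.iInf_add,
    ENNReal.mul_iInf_of_ne (by simp; linarith) ENNReal.ofReal_ne_top, ENNReal.iInf_add]
  exact le_iInf hmem
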